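/- Let $n\ge 0$, let $A\subset\mathbb{R}^n$ be any set, and let $\epsilon=(\epsilon_1,\dots,\epsilon_n)$ be a vector of independent real random variables with $|\epsilon_i|\le 1$ almost surely for every $i$. Let $\langle\cdot,\cdot\rangle$ and $\|\cdot\|$ be the Euclidean inner product and norm. Then $\sup_{z\in A}\langle\epsilon,z\rangle$ is a random variable with values in $[-\infty,\infty]$ whose expectation is well defined in $[-\infty,\infty]$, and for every real $s>0$ $$\Pr\Big\{\sup_{z\in A}\langle\epsilon,z\rangle>\mathbb{E}\sup_{z\in A}\langle\epsilon,z\rangle+s\Big\}\le\exp\left(\frac{-s^2}{8\sup_{z\in A}\|z\|^2}\right).$$ If, instead of satisfying $|\epsilon_i|\le 1$, the independent variables $\epsilon_i$ are standard normal, then the same conclusion holds with the constant $8$ replaced by $2$. Here the right-hand side is read as $1$ if $\sup_{z\in A}\|z\|=\infty$ and as $0$ if $\sup_{z\in A}\|z\|=0$; for $A=\emptyset$ the supremum of $\langle\epsilon,z\rangle$ is $-\infty$ and that of the norms is $0$. -/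

import Mathlib

open MeasureTheory ProbabilityTheory
open scoped ENNReal

noncomputable section

/-- The expectation `E[X⁺] - E[X⁻]` of an extended real random variable, as an extended real.
It is meaningful under `HasExpectation`. -/
def expectation {Ω : Type*} [MeasurableSpace Ω] (P : Measure Ω) (X : Ω → EReal) : EReal :=
  ((∫⁻ ω, (X ω).toENNReal ∂P : ℝ≥0∞) : EReal) - ((∫⁻ ω, (-X ω).toENNReal ∂P : ℝ≥0∞) : EReal)

/-- `X` is measurable and `E[X⁺]`, `E[X⁻]` are not both infinite, so that the expectation of `X`
is well defined in `[-∞, ∞]`. -/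
def HasExpectation {Ω : Type*} [MeasurableSpace Ω] (P : Measure Ω) (X : Ω → EReal) : Prop :=
  Measurable X ∧ (∫⁻ ω, (X ω).toENNReal ∂P ≠ ∞ ∨ ∫⁻ ω, (-X ω).toENNReal ∂P ≠ ∞)

/-- For an integrable real random variable, `expectation` is the Bochner integral. -/
theorem expectation_coe {Ω : Type*} [MeasurableSpace Ω] {P : Measure Ω} {f : Ω → ℝ}
    (hf : Integrable f P) :
    expectation P (fun ω => (f ω : EReal)) = ((∫ ω, f ω ∂P : ℝ) : EReal) := by
  have h1 : ∫⁻ ω, ENNReal.ofReal (f ω) ∂P ≠ ∞ := hf.lintegral_lt_top.ne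
  have h2 : ∫⁻ ω, ENNReal.ofReal (-f ω) ∂P ≠ ∞ := hf.neg.lintegral_lt_top.ne
  rw [integral_eq_lintegral_pos_part_sub_lintegral_neg_part hf, EReal.coe_sub,
    EReal.coe_ennreal_toReal h1, EReal.coe_ennreal_toReal h2]
  simp only [expectation, ← EReal.coe_neg, EReal.toENNReal_of_ne_top (EReal.coe_ne_top _),
    EReal.toReal_coe]

/-- The supremum of `⟨x, z⟩` over `z ∈ A`, as an extended real (`-∞` if `A` is empty). -/
def supInner {n : ℕ} (A : Set (EuclideanSpace ℝ (Fin n))) (x : EuclideanSpace ℝ (Fin n)) :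
    EReal :=
  ⨆ z ∈ A, ((inner ℝ x z : ℝ) : EReal)

/-- The supremum of the Euclidean norms of the elements of `A`, in `[0, ∞]`. -/
def supNorm {n : ℕ} (A : Set (EuclideanSpace ℝ (Fin n))) : ℝ≥0∞ :=
  ⨆ z ∈ A, ‖z‖ₑ

/-- `exp (-s² / (c v²))` for `v ∈ [0, ∞]`; for `s > 0` and `c > 0` it is `0` if `v = 0` and
`1` if `v = ∞`. -/
def gaussianBound (c : ℝ≥0∞) (s : ℝ) (v : ℝ≥0∞) : ℝ≥0∞ :=
  EReal.exp (-((ENNReal.ofReal (s ^ 2) / (c * v ^ 2) : ℝ≥0∞) : EReal))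

/-- For a positive real `v`, `gaussianBound` is the usual real exponential. -/
theorem gaussianBound_ofReal {c s v : ℝ} (hc : 0 < c) (hv : 0 < v) :
    gaussianBound (ENNReal.ofReal c) s (ENNReal.ofReal v) =
      ENNReal.ofReal (Real.exp (-s ^ 2 / (c * v ^ 2))) := by
  have h : 0 < c * v ^ 2 := by positivity
  rw [gaussianBound, ← ENNReal.ofReal_pow hv.le, ← ENNReal.ofReal_mul hc.le,
    ← ENNReal.ofReal_div_of_pos h, EReal.coe_ennreal_ofReal, max_eq_left (by positivity),
    ← EReal.coe_neg, EReal.exp_coe, neg_div]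

end

/-! The argument is Maurey's inf-convolution method. If every coordinate law satisfies
`InfConvInequality` with constant c, so does the product law with cost c|x - y|²
(`InfConvInequality.pi`). For f convex and v-Lipschitz, v|x - y| ≤ c|x - y|² + v²/(4c), so the pair
q = f - v²/(4c), g = f is admissible and ∫ e^f ≤ exp(∫ f + v²/(4c)). Chernoff's bound then gives the
tail exp(-c s²/v²).

In dimension one, c = 1/8 for laws on [-1, 1] (`infConvInequality_of_ae_mem_Icc`, using convexity of
g), and c = 1/2 for the Gaussian conditioned on [-R, R] (`integral_exp_le_of_transport`, by monotone
transport); the truncation is removed in the limit. The constants 8 and 2 are 1/c.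

The method is applied to maxima of finitely many linear forms ⟨·, z⟩, z ∈ A, which are convex and
Lipschitz with constant at most sup ‖z‖. Along a dense sequence in A they increase to the full
supremum. -/

/-- A dual (inf-convolution) form of a quadratic transport inequality for convex functions, for a
measure on `[-R, R]`. -/
def InfConvInequality (R c : ℝ) (μ : Measure ℝ) : Prop :=
  ∀ q g : ℝ → ℝ, Continuous q → Continuous g → ConvexOn ℝ Set.univ g →
    (∀ x ∈ Set.Icc (-R) R, ∀ y ∈ Set.Icc (-R) R, q x ≤ g y + c * (x - y) ^ 2) →
    ∫ x, Real.exp (q x) ∂μ ≤ Real.exp (∫ x, g x ∂μ)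

/-! ### Laws on [-1, 1] in dimension one -/

theorem add_sq_half_le_neg_log_one_sub {w : ℝ} (h0 : 0 ≤ w) (h1 : w < 1) :
    w + w ^ 2 / 2 ≤ -Real.log (1 - w) := by
  have h := Real.hasSum_pow_div_log_of_abs_lt_one (x := w) (by rwa [abs_of_nonneg h0])
  have h2 := sum_le_hasSum (Finset.range 2) (fun i _ => by positivity) h
  norm_num [Finset.sum_range_succ] at h2
  linarith

/-- Two terms of the series of -log(1 - w) at w = 1 - 1/h, times h. The quadratic term will pay for
the transport cost. -/
theorem sub_one_add_sq_div_le_mul_log {h : ℝ} (hh : 1 ≤ h) :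
    h - 1 + (h - 1) ^ 2 / (2 * h) ≤ h * Real.log h := by
  have hpos : 0 < h := by linarith
  have hinv : h⁻¹ ≤ 1 := inv_le_one_of_one_le₀ hh
  have hip : 0 < h⁻¹ := by positivity
  have key := add_sq_half_le_neg_log_one_sub (w := 1 - h⁻¹) (by linarith) (by linarith)
  rw [sub_sub_cancel, Real.log_inv, neg_neg] at key
  have := mul_le_mul_of_nonneg_left key hpos.le
  refine le_trans (le_of_eq ?_) this
  field_simp

theorem sub_one_le_mul_log {h : ℝ} (hh : 0 < h) : h - 1 ≤ h * Real.log h := by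
  have key := mul_le_mul_of_nonneg_left (Real.one_sub_inv_le_log_of_pos hh) hh.le
  refine le_trans (le_of_eq ?_) key
  field_simp

/-- The choice is t = (1 - 1/h)⁺, the fraction of the mass at a point that exceeds the reference
mass. After multiplication by h the cost is (h - 1)²/(2h), which h log h absorbs. -/
theorem mul_add_sub_one_le_of_forall_convex_bound {h r a G : ℝ} (hh : 0 < h)
    (H : ∀ t ∈ Set.Icc (0 : ℝ) 1, Real.log h + r ≤ (1 - t) * a + t * G + t ^ 2 / 2) :
    h * r + h - 1 ≤ a - max (1 - h) 0 * a + max (h - 1) 0 * G := by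
  rcases le_total h 1 with h1 | h1
  · rw [max_eq_left (by linarith), max_eq_right (by linarith)]
    have := mul_le_mul_of_nonneg_left (H 0 (by simp)) hh.le
    have := sub_one_le_mul_log hh
    linarith
  · rw [max_eq_right (by linarith), max_eq_left (by linarith)]
    have hinv : h⁻¹ ≤ 1 := inv_le_one_of_one_le₀ h1
    have hip : 0 < h⁻¹ := by positivity
    have h2 := mul_le_mul_of_nonneg_left (H (1 - h⁻¹) ⟨by linarith, by linarith⟩) hh.le
    have h3 := sub_one_add_sq_div_le_mul_log h1
    have h4 : h * ((1 - (1 - h⁻¹)) * a + (1 - h⁻¹) * G + (1 - h⁻¹) ^ 2 / 2)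
        = a + (h - 1) * G + (h - 1) ^ 2 / (2 * h) := by
      field_simp
      ring
    linarith

theorem integrable_of_continuous_of_ae_mem {X : Type*} [TopologicalSpace X] [T2Space X]
    [MeasurableSpace X] [OpensMeasurableSpace X] {μ : Measure X} [IsFiniteMeasure μ] {K : Set X}
    (hK : IsCompact K) (hμ : ∀ᵐ x ∂μ, x ∈ K) {f : X → ℝ} (hf : Continuous f) :
    Integrable f μ := by
  obtain ⟨C, hC⟩ := hK.exists_bound_of_continuousOn hf.continuousOn
  refine Integrable.of_bound hf.measurable.aestronglyMeasurable C ?_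
  filter_upwards [hμ] with x hx using hC x hx

/-- With h = e^q/Z, the excess (h - 1)⁺ and the deficit (1 - h)⁺ have the same mass B. Each point of
excess is compared with the deficit, on which g has average G; when the pointwise bounds are
integrated, the two terms B·G cancel and log Z ≤ ∫ g remains. -/
theorem infConvInequality_of_ae_mem_Icc {μ : Measure ℝ} [IsProbabilityMeasure μ]
    (hμ : ∀ᵐ x ∂μ, x ∈ Set.Icc (-1 : ℝ) 1) : InfConvInequality 1 (1 / 8) μ := by
  intro q g hq hg hconv H
  have int : ∀ f : ℝ → ℝ, Continuous f → Integrable f μ :=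
    fun f hf => integrable_of_continuous_of_ae_mem isCompact_Icc hμ hf
  set Z := ∫ x, Real.exp (q x) ∂μ with hZ
  have hZpos : 0 < Z := integral_exp_pos (int _ (by fun_prop))
  set h : ℝ → ℝ := fun x => Real.exp (q x) / Z with hh
  have hhc : Continuous h := by fun_prop
  have hhpos : ∀ x, 0 < h x := fun x => by positivity
  have hh1 : ∫ x, h x ∂μ = 1 := by
    simp only [hh]
    rw [integral_div, ← hZ, div_self hZpos.ne']
  have hlog : ∀ x, Real.log (h x) + Real.log Z = q x := fun x => by
    simp only [hh]
    rw [Real.log_div (Real.exp_pos _).ne' hZpos.ne', Real.log_exp]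
    ring
  set B := ∫ x, max (1 - h x) 0 ∂μ with hB
  have hBn : 0 ≤ B := integral_nonneg fun x => le_max_right _ _
  have hB' : ∫ x, max (h x - 1) 0 ∂μ = B := by
    have e : ∀ x, max (h x - 1) 0 = max (1 - h x) 0 + (h x - 1) := fun x => by
      rcases le_total (h x) 1 with h1 | h1
      · rw [max_eq_right (by linarith), max_eq_left (by linarith)]; ring
      · rw [max_eq_left (by linarith), max_eq_right (by linarith)]; ring
    simp_rw [e]
    rw [integral_add (int _ (by fun_prop)) (int _ (by fun_prop)),
      integral_sub (int _ (by fun_prop)) (int _ (by fun_prop)), hh1]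
    simp [hB]
  have hpt : ∀ x ∈ Set.Icc (-1 : ℝ) 1, ∀ y ∈ Set.Icc (-1 : ℝ) 1, ∀ t ∈ Set.Icc (0 : ℝ) 1,
      q x ≤ (1 - t) * g x + t * g y + t ^ 2 / 2 := by
    intro x hx y hy t ht
    have hm : (1 - t) * x + t * y ∈ Set.Icc (-1 : ℝ) 1 := by
      have := (convex_Icc (-1 : ℝ) 1) hx hy (a := 1 - t) (b := t) (by linarith [ht.2]) ht.1
        (by ring)
      simpa only [smul_eq_mul] using this
    have h1 := H x hx _ hm
    obtain ⟨-, hc⟩ := hconv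
    have h2 := hc (Set.mem_univ x) (Set.mem_univ y) (a := 1 - t) (b := t)
      (by linarith [ht.2]) ht.1 (by ring)
    simp only [smul_eq_mul] at h2
    -- The interval has length 2, so the cost is at most (1/8)·4t² = t²/2.
    have h3 : (x - y) ^ 2 ≤ 4 := by
      nlinarith [hx.1, hx.2, hy.1, hy.2]
    have h4 : (x - ((1 - t) * x + t * y)) ^ 2 = t ^ 2 * (x - y) ^ 2 := by ring
    rw [h4] at h1
    nlinarith [sq_nonneg t]
  -- a value `G` standing for the average of `g` against the deficit `(1 - h)⁺`
  obtain ⟨G, hG1, hG2⟩ : ∃ G : ℝ, (∀ x ∈ Set.Icc (-1 : ℝ) 1, ∀ t ∈ Set.Icc (0 : ℝ) 1,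
      q x ≤ (1 - t) * g x + t * G + t ^ 2 / 2) ∧ ∫ x, max (1 - h x) 0 * g x ∂μ = B * G := by
    rcases hBn.eq_or_lt with h0 | h0
    -- Without deficit both sides of the second condition vanish, and any value of g on the interval
    -- serves as G.
    · refine ⟨g 0, fun x hx t ht => hpt x hx 0 (by simp) t ht, ?_⟩
      rw [← h0, zero_mul]
      have := (integral_eq_zero_iff_of_nonneg (μ := μ) (f := fun x => max (1 - h x) 0)
        (fun x => le_max_right _ _) (int _ (by fun_prop))).1 h0.symm
      refine integral_eq_zero_of_ae ?_
      filter_upwards [this] with x hx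
      simp only [Pi.zero_apply] at hx ⊢
      rw [hx, zero_mul]
    · refine ⟨(∫ x, max (1 - h x) 0 * g x ∂μ) / B, fun x hx t ht => ?_, by field_simp⟩
      -- Average `hpt` over y against the deficit.
      have : ∫ y, max (1 - h y) 0 * q x ∂μ ≤
          ∫ y, (max (1 - h y) 0 * ((1 - t) * g x + t ^ 2 / 2)
            + t * (max (1 - h y) 0 * g y)) ∂μ := by
        refine integral_mono_ae (int _ (by fun_prop)) (int _ (by fun_prop)) ?_
        filter_upwards [hμ] with y hy
        have := mul_le_mul_of_nonneg_left (hpt x hx y hy t ht) (le_max_right (1 - h y) 0)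
        linarith
      rw [integral_add (int _ (by fun_prop)) (int _ (by fun_prop)), integral_mul_const,
        integral_mul_const, integral_const_mul, ← hB] at this
      rw [← mul_le_mul_iff_of_pos_left h0]
      refine this.trans (le_of_eq ?_)
      field_simp
      ring
  have main : ∫ x, (h x * Real.log Z + h x - 1) ∂μ ≤
      ∫ x, (g x - max (1 - h x) 0 * g x + max (h x - 1) 0 * G) ∂μ := by
    refine integral_mono_ae (int _ (by fun_prop)) (int _ (by fun_prop)) ?_
    filter_upwards [hμ] with x hx
    refine mul_add_sub_one_le_of_forall_convex_bound (hhpos x) fun t ht => ?_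
    rw [hlog]
    exact hG1 x hx t ht
  rw [integral_sub (int _ (by fun_prop)) (int _ (by fun_prop)),
    integral_add (int _ (by fun_prop)) (int _ (by fun_prop)), integral_mul_const, hh1,
    integral_add (int _ (by fun_prop)) (int _ (by fun_prop)),
    integral_sub (int _ (by fun_prop)) (int _ (by fun_prop)), integral_mul_const, hB', hG2] at main
  simp only [integral_const, probReal_univ, smul_eq_mul, one_mul, mul_one] at main
  rw [← Real.log_le_iff_le_exp hZpos]
  linarith

/-! ### The truncated Gaussian in dimension one -/

/-- The monotone transport between two positive continuous densities on `[a, b]` of the same total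
mass, extended to the line. -/
theorem exists_monotone_transport {a b : ℝ} (hab : a ≤ b) {φ k : ℝ → ℝ} (hφ : Continuous φ)
    (hk : Continuous k) (hφpos : ∀ x, 0 < φ x) (hkpos : ∀ x, 0 < k x)
    (hmass : ∫ x in a..b, φ x = ∫ x in a..b, k x) :
    ∃ T : ℝ → ℝ, T a = a ∧ T b = b ∧ (∀ x ∈ Set.Icc a b, T x ∈ Set.Icc a b) ∧
      ∀ x ∈ Set.Icc a b, HasDerivAt T (φ x / k (T x)) x := by
  -- Freezing k outside [a, b] keeps it above a positive constant, so its primitive G is a bijection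
  -- of the line. Then T = G⁻¹ ∘ Φ has two-sided derivatives even at a and b.
  set π : ℝ → ℝ := fun x => max a (min b x) with hπ
  have hπc : Continuous π := by fun_prop
  have hπmem : ∀ x, π x ∈ Set.Icc a b := fun x => ⟨le_max_left _ _, max_le hab (min_le_left _ _)⟩
  have hπid : ∀ x ∈ Set.Icc a b, π x = x := fun x hx => by
    simp only [hπ]; rw [min_eq_right hx.2, max_eq_right hx.1]
  set κ : ℝ → ℝ := fun x => k (π x) with hκ
  have hκc : Continuous κ := hk.comp hπc
  set G : ℝ → ℝ := fun x => ∫ t in a..x, κ t with hG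
  set Φ : ℝ → ℝ := fun x => ∫ t in a..x, φ t with hΦ
  have hGd : ∀ x, HasDerivAt G (κ x) x := fun x =>
    (hκc.integral_hasStrictDerivAt a x).hasDerivAt
  have hΦd : ∀ x, HasDerivAt Φ (φ x) x := fun x =>
    (hφ.integral_hasStrictDerivAt a x).hasDerivAt
  have hGmono : StrictMono G := strictMono_of_hasDerivAt_pos hGd fun x => hkpos _
  have hGc : Continuous G := continuous_iff_continuousAt.2 fun x => (hGd x).continuousAt
  have hΦmono : StrictMono Φ := strictMono_of_hasDerivAt_pos hΦd fun x => hφpos _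
  obtain ⟨z, hz, hzmin⟩ := isCompact_Icc.exists_isMinOn (Set.nonempty_Icc.2 hab) hk.continuousOn
  have hmin : ∀ x, k z ≤ κ x := fun x => hzmin (hπmem x)
  have hlin : Monotone fun x => G x - k z * x :=
    monotone_of_hasDerivAt_nonneg
      (f' := fun x => κ x - k z * 1)
      (fun x => (hGd x).sub ((hasDerivAt_id x).const_mul (k z)))
      (fun x => by simpa using hmin x)
  have htop : Filter.Tendsto G Filter.atTop Filter.atTop := by
    have h1 : Filter.Tendsto (fun x => k z * x + (G 0 - k z * 0)) Filter.atTop Filter.atTop :=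
      Filter.tendsto_atTop_add_const_right _ _ (Filter.tendsto_id.const_mul_atTop (hkpos z))
    refine Filter.tendsto_atTop_mono' _ ?_ h1
    filter_upwards [Filter.eventually_ge_atTop 0] with x hx
    have := hlin hx
    simp only at this
    linarith
  have hbot : Filter.Tendsto G Filter.atBot Filter.atBot := by
    have h1 : Filter.Tendsto (fun x => k z * x + (G 0 - k z * 0)) Filter.atBot Filter.atBot :=
      Filter.tendsto_atBot_add_const_right _ _ (Filter.tendsto_id.const_mul_atBot (hkpos z))
    refine Filter.tendsto_atBot_mono' _ ?_ h1
    filter_upwards [Filter.eventually_le_atBot 0] with x hx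
    have := hlin hx
    simp only at this
    linarith
  have hsurj : Function.Surjective G := hGc.surjective htop hbot
  set e := (hGmono.orderIsoOfSurjective G hsurj).toHomeomorph with he
  have hes : ∀ x, e.symm (G x) = x := fun x => e.symm_apply_apply x
  have hGe : ∀ x, G (e.symm x) = x := fun x => e.apply_symm_apply x
  have hGa : G a = Φ a := by simp [hG, hΦ]
  have hGb : G b = Φ b := by
    simp only [hG, hΦ]
    rw [hmass]
    refine intervalIntegral.integral_congr fun x hx => ?_
    rw [Set.uIcc_of_le hab] at hx
    simp only [hκ, hπid x hx]
  have hTa : e.symm (Φ a) = a := by rw [← hGa, hes]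
  have hTb : e.symm (Φ b) = b := by rw [← hGb, hes]
  have hTmem : ∀ x ∈ Set.Icc a b, e.symm (Φ x) ∈ Set.Icc a b := fun x hx => by
    constructor
    · rw [← hGmono.le_iff_le, hGe, hGa]; exact hΦmono.monotone hx.1
    · rw [← hGmono.le_iff_le, hGe, hGb]; exact hΦmono.monotone hx.2
  refine ⟨fun x => e.symm (Φ x), hTa, hTb, hTmem, fun x hx => ?_⟩
  have hinv : HasDerivAt e.symm (κ (e.symm (Φ x)))⁻¹ (Φ x) :=
    HasDerivAt.of_local_left_inverse e.symm.continuous.continuousAt (hGd _) (hkpos _).ne'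
      (Filter.Eventually.of_forall hGe)
  have := hinv.comp x (hΦd x)
  simp only [hκ, hπid _ (hTmem x hx)] at this
  rw [div_eq_inv_mul]
  exact this

/-- T carries the density φ to k = e^q φ/Z. The logarithm of T' = φ/(k ∘ T), bounded by T' - 1,
gives log Z ≤ g(x) plus a term that, weighted by φ, is an exact derivative. -/
theorem integral_exp_le_of_transport {R : ℝ} (hR : 0 < R) {q g φ : ℝ → ℝ} (hq : Continuous q)
    (hg : Continuous g) (hφ : φ = fun x => Real.exp (-x ^ 2 / 2))
    (H : ∀ x ∈ Set.Icc (-R) R, ∀ y ∈ Set.Icc (-R) R, q x ≤ g y + 1 / 2 * (x - y) ^ 2) :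
    (∫ x in -R..R, Real.exp (q x) * φ x) / (∫ x in -R..R, φ x) ≤
      Real.exp ((∫ x in -R..R, g x * φ x) / (∫ x in -R..R, φ x)) := by
  have hRR : -R < R := by linarith
  have hφc : Continuous φ := by rw [hφ]; fun_prop
  have hφpos : ∀ x, 0 < φ x := fun x => by rw [hφ]; positivity
  have hφlog : ∀ x, Real.log (φ x) = -x ^ 2 / 2 := fun x => by rw [hφ, Real.log_exp]
  have hφd : ∀ x, HasDerivAt φ (-x * φ x) x := fun x => by
    have h1 : HasDerivAt (fun x : ℝ => -x ^ 2 / 2) (-x) x := by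
      have := ((hasDerivAt_pow 2 x).neg).div_const 2
      refine this.congr_deriv ?_
      simp
      ring
    rw [hφ]
    exact h1.exp.congr_deriv (mul_comm _ _)
  set m := ∫ x in -R..R, φ x with hm
  have hmpos : 0 < m := intervalIntegral.intervalIntegral_pos_of_pos
    (hφc.intervalIntegrable _ _) hφpos hRR
  set J := ∫ x in -R..R, Real.exp (q x) * φ x with hJ
  have hJpos : 0 < J := intervalIntegral.intervalIntegral_pos_of_pos
    (Continuous.intervalIntegrable (by fun_prop) _ _)
    (fun x => mul_pos (Real.exp_pos _) (hφpos x)) hRR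
  have hZpos : 0 < J / m := by positivity
  set k : ℝ → ℝ := fun x => Real.exp (q x) * φ x / (J / m) with hk
  have hkc : Continuous k := by fun_prop
  have hkpos : ∀ x, 0 < k x := fun x => div_pos (mul_pos (Real.exp_pos _) (hφpos x)) hZpos
  have hklog : ∀ x, Real.log (k x) = q x - x ^ 2 / 2 - Real.log (J / m) := fun x => by
    simp only [hk]
    rw [Real.log_div (mul_pos (Real.exp_pos _) (hφpos x)).ne' hZpos.ne',
      Real.log_mul (Real.exp_pos _).ne' (hφpos x).ne', Real.log_exp, hφlog]
    ring
  have hmass : ∫ x in -R..R, φ x = ∫ x in -R..R, k x := by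
    simp only [hk]
    rw [intervalIntegral.integral_div, ← hm, ← hJ]
    field_simp
  obtain ⟨T, hTa, hTb, hTmem, hTd⟩ := exists_monotone_transport hRR.le hφc hkc hφpos hkpos hmass
  have hTc : ContinuousOn T (Set.Icc (-R) R) := fun x hx => (hTd x hx).continuousAt.continuousWithinAt
  -- The derivative of -φ(x)(x - T x). Its integral is zero because T fixes both endpoints.
  set D : ℝ → ℝ := fun x => -(-x * φ x * (x - T x) + φ x * (1 - φ x / k (T x))) with hD
  have hDd : ∀ x ∈ Set.Icc (-R) R, HasDerivAt (fun x => -(φ x * (x - T x))) (D x) x :=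
    fun x hx => ((hφd x).mul ((hasDerivAt_id x).sub (hTd x hx))).neg
  have hDc : ContinuousOn D (Set.Icc (-R) R) := by
    have h1 : ContinuousOn (fun x => k (T x)) (Set.Icc (-R) R) := hkc.comp_continuousOn hTc
    have h2 : ContinuousOn (fun x => φ x / k (T x)) (Set.Icc (-R) R) :=
      hφc.continuousOn.div h1 fun x _ => (hkpos _).ne'
    fun_prop
  have hDi : IntervalIntegrable D volume (-R) R :=
    ContinuousOn.intervalIntegrable (by rwa [Set.uIcc_of_le hRR.le])
  have hDint : ∫ x in -R..R, D x = 0 := by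
    rw [intervalIntegral.integral_eq_sub_of_hasDerivAt
      (fun x hx => hDd x (by rwa [Set.uIcc_of_le hRR.le] at hx)) hDi, hTa, hTb]
    simp
  have hpt : ∀ x ∈ Set.Icc (-R) R, Real.log (J / m) * φ x ≤ g x * φ x + D x := by
    intro x hx
    set d := φ x / k (T x) with hd
    have hdpos : 0 < d := div_pos (hφpos x) (hkpos _)
    have h1 : Real.log d = -x ^ 2 / 2 - (q (T x) - T x ^ 2 / 2 - Real.log (J / m)) := by
      rw [hd, Real.log_div (hφpos x).ne' (hkpos _).ne', hφlog, hklog]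
    have h2 := Real.log_le_sub_one_of_pos hdpos
    have h3 := H (T x) (hTmem x hx) x hx
    -- The quadratic terms collapse: (x - T x)²/2 + x²/2 - (T x)²/2 = x(x - T x).
    have h4 : Real.log (J / m) ≤ g x + (x * (x - T x) - (1 - d)) := by nlinarith
    have h5 := mul_le_mul_of_nonneg_right h4 (hφpos x).le
    simp only [hD, ← hd]
    linarith
  have hmono := intervalIntegral.integral_mono_on hRR.le
    (Continuous.intervalIntegrable (by fun_prop) _ _)
    ((Continuous.intervalIntegrable (by fun_prop) _ _).add hDi) hpt
  rw [intervalIntegral.integral_const_mul,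
    intervalIntegral.integral_add (Continuous.intervalIntegrable (by fun_prop) _ _) hDi, hDint,
    ← hm, add_zero] at hmono
  rw [← Real.log_le_iff_le_exp hZpos, le_div_iff₀ hmpos]
  exact hmono

theorem integral_cond_gaussianReal {R : ℝ} (hR : 0 < R) (f : ℝ → ℝ) :
    ∫ x, f x ∂(ProbabilityTheory.cond (gaussianReal 0 1) (Set.Icc (-R) R)) =
      (∫ x in -R..R, f x * Real.exp (-x ^ 2 / 2)) / ∫ x in -R..R, Real.exp (-x ^ 2 / 2) := by
  have key : ∀ f : ℝ → ℝ, ∫ x in Set.Icc (-R) R, f x ∂(gaussianReal 0 1) =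
      (√(2 * Real.pi))⁻¹ * ∫ x in -R..R, f x * Real.exp (-x ^ 2 / 2) := by
    intro f
    rw [gaussianReal_of_var_ne_zero _ one_ne_zero, restrict_withDensity measurableSet_Icc,
      integral_withDensity_eq_integral_toReal_smul (measurable_gaussianPDF _ _)
        (Filter.Eventually.of_forall fun _ => gaussianPDF_lt_top),
      intervalIntegral.integral_of_le (by linarith), ← integral_Icc_eq_integral_Ioc,
      ← integral_const_mul]
    congr 1
    ext x
    simp [toReal_gaussianPDF, gaussianPDFReal]
    ring
  have hreal : (gaussianReal 0 1).real (Set.Icc (-R) R) =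
      (√(2 * Real.pi))⁻¹ * ∫ x in -R..R, Real.exp (-x ^ 2 / 2) := by
    have := key (fun _ => 1)
    simpa using this
  rw [ProbabilityTheory.cond, integral_smul_measure, key, ENNReal.toReal_inv, ← measureReal_def, hreal, smul_eq_mul]
  have : (√(2 * Real.pi))⁻¹ ≠ 0 := by positivity
  rw [mul_inv, div_eq_mul_inv]
  field_simp

theorem infConvInequality_cond_gaussianReal {R : ℝ} (hR : 0 < R) :
    InfConvInequality R (1 / 2) (ProbabilityTheory.cond (gaussianReal 0 1) (Set.Icc (-R) R)) := by
  intro q g hq hg _ H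
  rw [integral_cond_gaussianReal hR, integral_cond_gaussianReal hR]
  exact integral_exp_le_of_transport hR hq hg rfl H

/-! ### Tensorization -/

/-- Induction on the dimension: the one-dimensional inequality is applied to log ∫ e^q and ∫ g, both
integrals over the remaining coordinates. Compact support makes these marginals continuous, and
integration preserves convexity. -/
theorem InfConvInequality.pi {R c : ℝ} : ∀ {n : ℕ} {μ : Fin n → Measure ℝ}
    [∀ i, IsProbabilityMeasure (μ i)], (∀ i, ∀ᵐ x ∂μ i, x ∈ Set.Icc (-R) R) →
    (∀ i, InfConvInequality R c (μ i)) → ∀ {q g : (Fin n → ℝ) → ℝ}, Continuous q →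
    Continuous g → ConvexOn ℝ Set.univ g →
    (∀ x y : Fin n → ℝ, (∀ i, x i ∈ Set.Icc (-R) R) → (∀ i, y i ∈ Set.Icc (-R) R) →
      q x ≤ g y + c * ∑ i, (x i - y i) ^ 2) →
    ∫ x, Real.exp (q x) ∂(Measure.pi μ) ≤ Real.exp (∫ x, g x ∂(Measure.pi μ)) := by
  intro n
  induction n with
  | zero =>
    intro μ _ _ _ q g _ _ _ H
    rw [Measure.pi_of_empty μ 0, integral_dirac, integral_dirac, Real.exp_le_exp]
    simpa using H 0 0 (fun i => i.elim0) (fun i => i.elim0)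
  | succ n ih =>
    intro μ _ hμ hineq q g hq hg hconv H
    set ν := Measure.pi fun j : Fin n => μ (Fin.succ j) with hν
    set K : Set (Fin n → ℝ) := Set.univ.pi fun _ => Set.Icc (-R) R with hK
    have hKc : IsCompact K := isCompact_univ_pi fun _ => isCompact_Icc
    have hνK : ∀ᵐ y ∂ν, y ∈ K := by
      have : ∀ᵐ y ∂ν, ∀ i, y i ∈ Set.Icc (-R) R :=
        ae_all_iff.2 fun i => (Measure.quasiMeasurePreserving_eval _ i).ae (hμ i.succ)
      filter_upwards [this] with y hy i _ using hy i
    have hνr : ν.restrict K = ν := Measure.restrict_eq_self_of_ae_mem hνK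
    have hcons : Continuous fun p : ℝ × (Fin n → ℝ) => (Fin.cons p.1 p.2 : Fin (n + 1) → ℝ) := by
      refine continuous_pi fun i => ?_
      refine Fin.cases ?_ (fun j => ?_) i
      · simpa using continuous_fst
      · simp only [Fin.cons_succ]
        fun_prop
    have hcons' : ∀ x : ℝ, Continuous fun y : Fin n → ℝ => (Fin.cons x y : Fin (n + 1) → ℝ) :=
      fun x => hcons.comp (by fun_prop : Continuous fun y : Fin n → ℝ => (x, y))
    have int : ∀ f : (Fin n → ℝ) → ℝ, Continuous f → Integrable f ν :=
      fun f hf => integrable_of_continuous_of_ae_mem hKc hνK hf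
    have hpar : ∀ f : (Fin (n + 1) → ℝ) → ℝ, Continuous f →
        Continuous fun x => ∫ y, f (Fin.cons x y) ∂ν := by
      intro f hf
      have := continuous_parametric_integral_of_continuous (μ := ν)
        (f := fun (x : ℝ) (y : Fin n → ℝ) => f (Fin.cons x y)) (hf.comp hcons) hKc
      rwa [hνr] at this
    have hpi : ∀ f : (Fin (n + 1) → ℝ) → ℝ, Continuous f →
        ∫ x, f x ∂(Measure.pi μ) = ∫ x, ∫ y, f (Fin.cons x y) ∂ν ∂(μ 0) := by
      intro f hf
      have hmp := (measurePreserving_piFinSuccAbove μ 0).symm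
      rw [← hmp.integral_comp']
      have hf' : Continuous fun p : ℝ × (Fin n → ℝ) => f (Fin.cons p.1 p.2) := hf.comp hcons
      have hKp : ∀ᵐ p ∂((μ 0).prod ν), p ∈ Set.Icc (-R) R ×ˢ K := by
        filter_upwards [Measure.quasiMeasurePreserving_fst.ae (hμ 0),
          Measure.quasiMeasurePreserving_snd.ae hνK] with p h1 h2 using ⟨h1, h2⟩
      have hint := integrable_of_continuous_of_ae_mem (isCompact_Icc.prod hKc) hKp hf'
      simp only [Fin.succAbove_zero]
      rw [← hν, ← integral_prod _ hint]
      refine integral_congr_ae (Filter.Eventually.of_forall fun p => ?_)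
      simp [MeasurableEquiv.piFinSuccAbove]
      rfl
    have hgi : ∀ x, Integrable (fun y => g (Fin.cons x y)) ν := fun x => int _ (hg.comp (hcons' x))
    rw [hpi _ (by fun_prop), hpi _ hg]
    have hpos : ∀ x, 0 < ∫ y, Real.exp (q (Fin.cons x y)) ∂ν := fun x =>
      integral_exp_pos (int _ (Real.continuous_exp.comp (hq.comp (hcons' x))))
    have h1 := hineq 0 (fun x => Real.log (∫ y, Real.exp (q (Fin.cons x y)) ∂ν))
      (fun x => ∫ y, g (Fin.cons x y) ∂ν)
      ((hpar (fun z => Real.exp (q z)) (by fun_prop)).log fun x => (hpos x).ne') (hpar _ hg) ?_ ?_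
    · simpa only [Real.exp_log (hpos _)] using h1
    · refine ⟨convex_univ, fun x _ y _ a b ha hb hab => ?_⟩
      simp only [smul_eq_mul]
      rw [← integral_const_mul, ← integral_const_mul,
        ← integral_add ((hgi x).const_mul a) ((hgi y).const_mul b)]
      refine integral_mono (hgi _)
        (((hgi x).const_mul a).add ((hgi y).const_mul b)) fun z => ?_
      have := hconv.2 (Set.mem_univ (Fin.cons x z : Fin (n + 1) → ℝ))
        (Set.mem_univ (Fin.cons y z : Fin (n + 1) → ℝ)) ha hb hab
      refine le_trans (le_of_eq (congrArg g ?_)) this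
      funext i
      refine Fin.cases ?_ (fun j => ?_) i
      · simp
      · simp [← add_mul, hab]
    · intro x hx y hy
      rw [Real.log_le_iff_le_exp (hpos x)]
      -- For fixed first coordinates x and y, their cost c(x - y)² is a constant subtracted from q;
      -- the induction hypothesis handles the rest.
      have h2 := ih (fun i => hμ i.succ) (fun i => hineq i.succ)
        (q := fun z => q (Fin.cons x z) - c * (x - y) ^ 2) (g := fun z => g (Fin.cons y z))
        ((hq.comp (hcons' x)).sub continuous_const) (hg.comp (hcons' y)) ?_ ?_
      · simp only [Real.exp_sub] at h2
        rw [integral_div, div_le_iff₀ (Real.exp_pos _), ← Real.exp_add] at h2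
        exact h2
      · refine ⟨convex_univ, fun z _ w _ a b ha hb hab => ?_⟩
        have := hconv.2 (Set.mem_univ (Fin.cons y z : Fin (n + 1) → ℝ))
          (Set.mem_univ (Fin.cons y w : Fin (n + 1) → ℝ)) ha hb hab
        refine le_trans (le_of_eq (congrArg g ?_)) this
        funext i
        refine Fin.cases ?_ (fun j => ?_) i
        · simp [← add_mul, hab]
        · simp
      · intro z w hz hw
        have := H (Fin.cons x z) (Fin.cons y w)
          (fun i => Fin.cases (by simpa using hx) (fun j => by simpa using hz j) i)
          (fun i => Fin.cases (by simpa using hy) (fun j => by simpa using hw j) i)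
        rw [Fin.sum_univ_succ] at this
        simp only [Fin.cons_zero, Fin.cons_succ] at this
        linarith

/-! ### Exponential moments of convex Lipschitz functions -/

theorem integral_exp_pi_le {n : ℕ} {R c v : ℝ} (hc : 0 < c) {μ : Fin n → Measure ℝ}
    [∀ i, IsProbabilityMeasure (μ i)] (hμ : ∀ i, ∀ᵐ x ∂μ i, x ∈ Set.Icc (-R) R)
    (hineq : ∀ i, InfConvInequality R c (μ i)) {f : (Fin n → ℝ) → ℝ} (hf : Continuous f)
    (hconv : ConvexOn ℝ Set.univ f)
    (hlip : ∀ x y, f x ≤ f y + v * √(∑ i, (x i - y i) ^ 2)) :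
    ∫ x, Real.exp (f x) ∂(Measure.pi μ) ≤
      Real.exp (∫ x, f x ∂(Measure.pi μ) + v ^ 2 / (4 * c)) := by
  have h := InfConvInequality.pi hμ hineq (q := fun x => f x - v ^ 2 / (4 * c)) (g := f)
    (by fun_prop) hf hconv fun x y _ _ => by
      have h1 := hlip x y
      set S := √(∑ i, (x i - y i) ^ 2) with hS
      have h2 : S ^ 2 = ∑ i, (x i - y i) ^ 2 :=
        Real.sq_sqrt (Finset.sum_nonneg fun i _ => sq_nonneg _)
      have h3 : c * S ^ 2 + v ^ 2 / (4 * c) - v * S = c * (S - v / (2 * c)) ^ 2 := by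
        field_simp
        ring
      have h4 : 0 ≤ c * (S - v / (2 * c)) ^ 2 := by positivity
      rw [← h2]
      linarith
  simp only [Real.exp_sub] at h
  rwa [integral_div, div_le_iff₀ (Real.exp_pos _), ← Real.exp_add] at h

theorem pi_cond_eq_cond_pi {ι : Type*} [Fintype ι] {X : ι → Type*}
    [∀ i, MeasurableSpace (X i)] (μ : ∀ i, Measure (X i)) [∀ i, IsProbabilityMeasure (μ i)]
    {s : ∀ i, Set (X i)} (hs : ∀ i, MeasurableSet (s i)) :
    Measure.pi (fun i => (μ i)[|s i]) = (Measure.pi μ)[|Set.univ.pi s] := by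
  refine Measure.pi_eq fun t _ => ?_
  rw [cond_apply (MeasurableSet.univ_pi hs), ← Set.pi_inter_distrib, Measure.pi_pi, Measure.pi_pi,
    ENNReal.prod_inv_distrib, ← Finset.prod_mul_distrib]
  · exact Finset.prod_congr rfl fun i _ => (cond_apply (hs i) _ _).symm
  · exact fun i _ j _ _ => Or.inr (measure_ne_top _ _)

/-- Conditioning on growing cubes gives products of truncated Gaussians, with a bound independent of
the cube. Both integrals converge by the integrability assumptions. -/
theorem integral_exp_pi_gaussianReal_le {n : ℕ} {v : ℝ} {f : (Fin n → ℝ) → ℝ} (hf : Continuous f)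
    (hconv : ConvexOn ℝ Set.univ f)
    (hlip : ∀ x y, f x ≤ f y + v * √(∑ i, (x i - y i) ^ 2))
    (hfi : Integrable f (Measure.pi fun _ : Fin n => gaussianReal 0 1))
    (hei : Integrable (fun x => Real.exp (f x)) (Measure.pi fun _ : Fin n => gaussianReal 0 1)) :
    ∫ x, Real.exp (f x) ∂(Measure.pi fun _ : Fin n => gaussianReal 0 1) ≤
      Real.exp (∫ x, f x ∂(Measure.pi fun _ : Fin n => gaussianReal 0 1) + v ^ 2 / 2) := by
  set ν := Measure.pi fun _ : Fin n => gaussianReal 0 1 with hν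
  -- The added 1 gives the interval positive measure already at k = 0.
  set I : ℕ → Set ℝ := fun k => Set.Icc (-((k : ℝ) + 1)) (k + 1) with hI
  set S : ℕ → Set (Fin n → ℝ) := fun k => Set.univ.pi fun _ => I k with hS
  have hSm : ∀ k, MeasurableSet (S k) := fun k => MeasurableSet.univ_pi fun _ => measurableSet_Icc
  have hImono : Monotone I := fun k l hkl => by
    have : (k : ℝ) ≤ l := by exact_mod_cast hkl
    exact Set.Icc_subset_Icc (by linarith) (by linarith)
  have hSmono : Monotone S := fun k l hkl => Set.pi_mono fun _ _ => hImono hkl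
  have hSU : ⋃ k, S k = Set.univ := by
    refine Set.eq_univ_of_forall fun x => ?_
    obtain ⟨k, hk⟩ := exists_nat_ge (∑ i, |x i|)
    refine Set.mem_iUnion.2 ⟨k, fun i _ => ?_⟩
    have h1 := Finset.single_le_sum (f := fun i => |x i|) (fun i _ => abs_nonneg _)
      (Finset.mem_univ i)
    have h2 : |x i| ≤ k + 1 := by linarith
    exact abs_le.1 h2
  have hlim : ∀ h : (Fin n → ℝ) → ℝ, Integrable h ν →
      Filter.Tendsto (fun k => ∫ x in S k, h x ∂ν) Filter.atTop (nhds (∫ x, h x ∂ν)) := by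
    intro h hh
    have := tendsto_setIntegral_of_monotone (μ := ν) (f := h) hSm hSmono hh.integrableOn
    rwa [hSU, setIntegral_univ] at this
  have hone : Filter.Tendsto (fun k => ν.real (S k)) Filter.atTop (nhds 1) := by
    simpa using hlim (fun _ => 1) (integrable_const 1)
  have hI0 : ∀ k, gaussianReal 0 1 (I k) ≠ 0 := fun k => by
    have h1 : volume (I k) ≠ 0 := by
      simp only [hI, Real.volume_Icc, ne_eq, ENNReal.ofReal_eq_zero, not_le]
      linarith [Nat.cast_nonneg (α := ℝ) k]
    exact fun h => h1 (gaussianReal_absolutelyContinuous' 0 one_ne_zero h)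
  have hc : ∀ (h : (Fin n → ℝ) → ℝ) k, ∫ x, h x ∂(ν[|S k]) =
      (ν.real (S k))⁻¹ * ∫ x in S k, h x ∂ν := fun h k => by
    rw [ProbabilityTheory.cond, integral_smul_measure, ENNReal.toReal_inv, ← measureReal_def,
      smul_eq_mul]
  have key : ∀ k, (ν.real (S k))⁻¹ * ∫ x in S k, Real.exp (f x) ∂ν ≤
      Real.exp ((ν.real (S k))⁻¹ * ∫ x in S k, f x ∂ν + v ^ 2 / 2) := by
    intro k
    rw [← hc, ← hc, hν, ← pi_cond_eq_cond_pi _ fun _ => measurableSet_Icc]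
    have : IsProbabilityMeasure ((gaussianReal 0 1)[|I k]) := cond_isProbabilityMeasure (hI0 k)
    have h := integral_exp_pi_le (n := n) (R := (k : ℝ) + 1) (c := 1 / 2) (by norm_num)
      (μ := fun _ => (gaussianReal 0 1)[|I k]) (fun _ => ae_cond_mem measurableSet_Icc)
      (fun _ => infConvInequality_cond_gaussianReal (by positivity)) hf hconv hlip
    rw [show (4 : ℝ) * (1 / 2) = 2 by norm_num] at h
    exact h
  have l1 := (hone.inv₀ one_ne_zero).mul (hlim _ hei)
  have l2 := (((hone.inv₀ one_ne_zero).mul (hlim _ hfi)).add_const (v ^ 2 / 2)).rexp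
  simpa using le_of_tendsto_of_tendsto' l1 l2 key

/-- The moment generating function of a convex Lipschitz function under `ν` has a Gaussian bound,
and linear forms have exponential moments under `ν`. -/
def ConvexSubgaussian {n : ℕ} (c : ℝ) (ν : Measure (Fin n → ℝ)) : Prop :=
  (∀ w : EuclideanSpace ℝ (Fin n),
    Integrable (fun x => Real.exp (inner ℝ (WithLp.toLp 2 x) w)) ν) ∧
  ∀ (f : (Fin n → ℝ) → ℝ) (v : ℝ), Continuous f → ConvexOn ℝ Set.univ f →
    (∀ x y, f x ≤ f y + v * √(∑ i, (x i - y i) ^ 2)) → Integrable f ν →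
    Integrable (fun x => Real.exp (f x)) ν →
    ∫ x, Real.exp (f x) ∂ν ≤ Real.exp (∫ x, f x ∂ν + v ^ 2 / (4 * c))

theorem convexSubgaussian_pi_of_ae_mem_Icc {n : ℕ} {μ : Fin n → Measure ℝ}
    [∀ i, IsProbabilityMeasure (μ i)] (hμ : ∀ i, ∀ᵐ x ∂μ i, x ∈ Set.Icc (-1 : ℝ) 1) :
    ConvexSubgaussian (1 / 8) (Measure.pi μ) := by
  refine ⟨fun w => ?_, fun f v hf hconv hlip _ _ => ?_⟩
  · have : ∀ᵐ x ∂(Measure.pi μ), x ∈ Set.univ.pi fun _ : Fin n => Set.Icc (-1 : ℝ) 1 := by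
      have : ∀ᵐ y ∂(Measure.pi μ), ∀ i, y i ∈ Set.Icc (-1 : ℝ) 1 :=
        ae_all_iff.2 fun i => (Measure.quasiMeasurePreserving_eval _ i).ae (hμ i)
      filter_upwards [this] with y hy i _ using hy i
    exact integrable_of_continuous_of_ae_mem (isCompact_univ_pi fun _ => isCompact_Icc) this
      (by fun_prop)
  · exact integral_exp_pi_le (by norm_num) hμ
      (fun i => infConvInequality_of_ae_mem_Icc (hμ i)) hf hconv hlip

theorem convexSubgaussian_pi_gaussianReal {n : ℕ} :
    ConvexSubgaussian (1 / 2) (Measure.pi fun _ : Fin n => gaussianReal 0 1) := by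
  refine ⟨fun w => ?_, fun f v hf hconv hlip hfi hei => ?_⟩
  · have : (fun x : Fin n → ℝ => Real.exp (inner ℝ (WithLp.toLp 2 x) w)) =
        fun x => ∏ i, Real.exp (w i * x i) := by
      ext x
      rw [← Real.exp_sum]
      simp [PiLp.inner_apply]
    rw [this]
    exact Integrable.fintype_prod fun i => integrable_exp_mul_gaussianReal (w i)
  · have h := integral_exp_pi_gaussianReal_le hf hconv hlip hfi hei
    norm_num at h ⊢
    exact h

/-! ### Finite maxima of linear forms and Chernoff's bound -/

/-- The maximum of `⟨x, u 0⟩, …, ⟨x, u k⟩`. -/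
noncomputable def maxInner {n : ℕ} (u : ℕ → EuclideanSpace ℝ (Fin n)) (k : ℕ) (x : Fin n → ℝ) : ℝ :=
  (Finset.range (k + 1)).sup' Finset.nonempty_range_add_one fun i => inner ℝ (WithLp.toLp 2 x) (u i)

section maxInner

variable {n : ℕ} {u : ℕ → EuclideanSpace ℝ (Fin n)}

theorem inner_le_maxInner {i k : ℕ} (hi : i ≤ k) (x : Fin n → ℝ) :
    inner ℝ (WithLp.toLp 2 x) (u i) ≤ maxInner u k x :=
  Finset.le_sup' (fun i => inner ℝ (WithLp.toLp 2 x) (u i))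
    (Finset.mem_range.2 (Nat.lt_succ_of_le hi))

theorem exists_maxInner_eq (k : ℕ) (x : Fin n → ℝ) :
    ∃ i ≤ k, maxInner u k x = inner ℝ (WithLp.toLp 2 x) (u i) := by
  obtain ⟨i, hi, h⟩ := Finset.exists_mem_eq_sup' (s := Finset.range (k + 1))
    Finset.nonempty_range_add_one fun i => inner ℝ (WithLp.toLp 2 x) (u i)
  exact ⟨i, Nat.lt_succ_iff.1 (Finset.mem_range.1 hi), h⟩

theorem maxInner_mono (x : Fin n → ℝ) : Monotone fun k => maxInner u k x := fun k l hkl => by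
  obtain ⟨i, hi, h⟩ := exists_maxInner_eq (u := u) k x
  simp only [h]
  exact inner_le_maxInner (hi.trans hkl) x

theorem continuous_maxInner (k : ℕ) : Continuous (maxInner u k) :=
  Continuous.finset_sup'_apply _ fun i _ => by fun_prop

theorem convexOn_maxInner (k : ℕ) : ConvexOn ℝ Set.univ (maxInner u k) := by
  refine ⟨convex_univ, fun x _ y _ a b ha hb _ => ?_⟩
  obtain ⟨i, hi, h⟩ := exists_maxInner_eq (u := u) k (a • x + b • y)
  rw [h, WithLp.toLp_add, WithLp.toLp_smul, WithLp.toLp_smul, inner_add_left, real_inner_smul_left,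
    real_inner_smul_left, smul_eq_mul, smul_eq_mul]
  gcongr <;> exact inner_le_maxInner hi _

theorem maxInner_le_add {k : ℕ} {v : ℝ} (hv : ∀ i ≤ k, ‖u i‖ ≤ v) (x y : Fin n → ℝ) :
    maxInner u k x ≤ maxInner u k y + v * √(∑ i, (x i - y i) ^ 2) := by
  obtain ⟨i, hi, h⟩ := exists_maxInner_eq (u := u) k x
  have h1 := real_inner_le_norm (WithLp.toLp 2 x - WithLp.toLp 2 y) (u i)
  have h2 : ‖(WithLp.toLp 2 x - WithLp.toLp 2 y : EuclideanSpace ℝ (Fin n))‖ =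
      √(∑ i, (x i - y i) ^ 2) := by
    rw [EuclideanSpace.norm_eq]
    simp
  rw [inner_sub_left, h2] at h1
  have h3 := inner_le_maxInner (u := u) hi y
  have h4 := mul_le_mul_of_nonneg_left (hv i hi) (Real.sqrt_nonneg (∑ i, (x i - y i) ^ 2))
  linarith

end maxInner

namespace ConvexSubgaussian

variable {n : ℕ} {c : ℝ} {ν : Measure (Fin n → ℝ)} {u : ℕ → EuclideanSpace ℝ (Fin n)}

theorem integrable_inner (h : ConvexSubgaussian c ν) (w : EuclideanSpace ℝ (Fin n)) :
    Integrable (fun x => inner ℝ (WithLp.toLp 2 x) w) ν := by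
  refine ((h.1 w).add (h.1 (-w))).mono' (Continuous.aestronglyMeasurable (by fun_prop))
    (Filter.Eventually.of_forall fun x => ?_)
  simp only [Pi.add_apply, inner_neg_right, Real.norm_eq_abs]
  set a : ℝ := inner ℝ (WithLp.toLp 2 x) w
  have h1 := Real.add_one_le_exp a
  have h2 := Real.add_one_le_exp (-a)
  have h3 := Real.exp_pos a
  have h4 := Real.exp_pos (-a)
  rw [abs_le]
  constructor <;> linarith

theorem integrable_maxInner (h : ConvexSubgaussian c ν) (k : ℕ) : Integrable (maxInner u k) ν := by
  refine (integrable_finsetSum (Finset.range (k + 1)) fun i _ =>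
    (h.integrable_inner (u i)).abs).mono' (continuous_maxInner k).aestronglyMeasurable
    (Filter.Eventually.of_forall fun x => ?_)
  obtain ⟨i, hi, he⟩ := exists_maxInner_eq (u := u) k x
  rw [he, Real.norm_eq_abs]
  exact Finset.single_le_sum (f := fun i => |inner ℝ (WithLp.toLp 2 x) (u i)|)
    (fun i _ => abs_nonneg _) (Finset.mem_range.2 (Nat.lt_succ_of_le hi))

theorem integrable_exp_mul_maxInner (h : ConvexSubgaussian c ν) (k : ℕ) (l : ℝ) :
    Integrable (fun x => Real.exp (l * maxInner u k x)) ν := by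
  have hc := continuous_maxInner (u := u) k
  refine (integrable_finsetSum (Finset.range (k + 1)) fun i _ => h.1 (l • u i)).mono'
    (Continuous.aestronglyMeasurable (by fun_prop)) (Filter.Eventually.of_forall fun x => ?_)
  obtain ⟨i, hi, he⟩ := exists_maxInner_eq (u := u) k x
  rw [he, Real.norm_eq_abs, abs_of_pos (Real.exp_pos _), ← real_inner_smul_right]
  exact Finset.single_le_sum (f := fun i => Real.exp (inner ℝ (WithLp.toLp 2 x) (l • u i)))
    (fun i _ => (Real.exp_pos _).le) (Finset.mem_range.2 (Nat.lt_succ_of_le hi))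

theorem measure_maxInner_ge_le [IsProbabilityMeasure ν] (h : ConvexSubgaussian c ν) (hc : 0 < c)
    {k : ℕ} {v s : ℝ} (hv : 0 < v) (hs : 0 < s) (hu : ∀ i ≤ k, ‖u i‖ ≤ v) :
    ν.real {x | ∫ y, maxInner u k y ∂ν + s ≤ maxInner u k x} ≤ Real.exp (-(c * s ^ 2 / v ^ 2)) := by
  -- The minimizer of l²v²/(4c) - l s, with minimum -c s²/v².
  set l : ℝ := 2 * c * s / v ^ 2 with hl
  have hlpos : 0 < l := by positivity
  have h1 := h.2 (fun x => l * maxInner u k x) (l * v) ((continuous_maxInner k).const_mul l)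
    ((convexOn_maxInner k).smul hlpos.le)
    (fun x y => by
      have := mul_le_mul_of_nonneg_left (maxInner_le_add hu x y) hlpos.le
      linarith)
    ((h.integrable_maxInner k).const_mul l) (h.integrable_exp_mul_maxInner k l)
  refine (measure_ge_le_exp_mul_mgf _ hlpos.le (h.integrable_exp_mul_maxInner k l)).trans ?_
  refine (mul_le_mul_of_nonneg_left h1 (Real.exp_pos _).le).trans (le_of_eq ?_)
  rw [← Real.exp_add, integral_const_mul]
  congr 1
  rw [hl]
  field_simp
  ring

end ConvexSubgaussian

/-! ### From finite maxima to the supremum over A -/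

theorem expectation_mono {Ω : Type*} [MeasurableSpace Ω] {P : Measure Ω} {X Y : Ω → EReal}
    (h : ∀ ω, X ω ≤ Y ω) : expectation P X ≤ expectation P Y := by
  refine EReal.sub_le_sub ?_ ?_
  · exact EReal.coe_ennreal_le_coe_ennreal_iff.2
      (lintegral_mono fun ω => EReal.toENNReal_le_toENNReal (h ω))
  · exact EReal.coe_ennreal_le_coe_ennreal_iff.2
      (lintegral_mono fun ω => EReal.toENNReal_le_toENNReal (EReal.neg_le_neg_iff.2 (h ω)))

theorem supInner_empty {n : ℕ} (x : EuclideanSpace ℝ (Fin n)) : supInner ∅ x = ⊥ := by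
  simp [supInner]

theorem exists_seq_dense_in {X : Type*} [TopologicalSpace X] [SecondCountableTopology X]
    {A : Set X} (hA : A.Nonempty) : ∃ u : ℕ → X, (∀ i, u i ∈ A) ∧ A ⊆ closure (Set.range u) := by
  have := hA.to_subtype
  obtain ⟨w, hw⟩ := TopologicalSpace.exists_dense_seq A
  refine ⟨fun i => w i, fun i => (w i).2, fun z hz => ?_⟩
  have h1 : (⟨z, hz⟩ : A) ∈ closure (Set.range w) := hw _
  rw [closure_subtype] at h1
  rwa [← Set.range_comp] at h1

theorem supInner_eq_iSup_maxInner {n : ℕ} {A : Set (EuclideanSpace ℝ (Fin n))}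
    {u : ℕ → EuclideanSpace ℝ (Fin n)} (hu : ∀ i, u i ∈ A) (hA : A ⊆ closure (Set.range u))
    (x : Fin n → ℝ) : supInner A (WithLp.toLp 2 x) = ⨆ k, (maxInner u k x : EReal) := by
  refine le_antisymm (iSup₂_le fun z hz => ?_) (iSup_le fun k => ?_)
  · have hcl : IsClosed {z : EuclideanSpace ℝ (Fin n) |
        ((inner ℝ (WithLp.toLp 2 x) z : ℝ) : EReal) ≤ ⨆ k, (maxInner u k x : EReal)} :=
      isClosed_le (continuous_coe_real_ereal.comp (by fun_prop)) continuous_const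
    refine closure_minimal ?_ hcl (hA hz)
    rintro _ ⟨i, rfl⟩
    exact (EReal.coe_le_coe_iff.2 (inner_le_maxInner le_rfl x)).trans
      (le_iSup (fun k => (maxInner u k x : EReal)) i)
  · obtain ⟨i, -, h⟩ := exists_maxInner_eq (u := u) k x
    rw [h]
    exact le_iSup₂ (f := fun z (_ : z ∈ A) => ((inner ℝ (WithLp.toLp 2 x) z : ℝ) : EReal))
      (u i) (hu i)

theorem ConvexSubgaussian.hasExpectation_and_tail {n : ℕ} {C : ℝ} (hC : 0 < C)
    (A : Set (EuclideanSpace ℝ (Fin n))) {Ω : Type*} [MeasurableSpace Ω] (P : Measure Ω)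
    [IsProbabilityMeasure P] {X : Ω → Fin n → ℝ} (hX : Measurable X)
    (h : ConvexSubgaussian (1 / C) (P.map X)) :
    HasExpectation P (fun ω => supInner A (WithLp.toLp 2 (X ω))) ∧
      ∀ s : ℝ, 0 < s →
        P {ω | supInner A (WithLp.toLp 2 (X ω)) >
          expectation P (fun ω => supInner A (WithLp.toLp 2 (X ω))) + (s : EReal)} ≤
        gaussianBound (ENNReal.ofReal C) s (supNorm A) := by
  have hprob : IsProbabilityMeasure (P.map X) := Measure.isProbabilityMeasure_map hX.aemeasurable
  rcases A.eq_empty_or_nonempty with rfl | hA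
  · simp only [supInner_empty]
    refine ⟨⟨measurable_const, Or.inl (by simp)⟩, fun s _ => ?_⟩
    have : expectation P (fun _ : Ω => (⊥ : EReal)) = ⊥ := by simp [expectation]
    simp [this]
  obtain ⟨u, hu, hAu⟩ := exists_seq_dense_in hA
  simp only [supInner_eq_iSup_maxInner hu hAu]
  set F : Ω → EReal := fun ω => ⨆ k, (maxInner u k (X ω) : EReal) with hF
  have hmm : ∀ k, Measurable fun ω => maxInner u k (X ω) := fun k =>
    (continuous_maxInner k).measurable.comp hX
  have hint : ∀ k, Integrable (fun ω => maxInner u k (X ω)) P := fun k =>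
    (h.integrable_maxInner k).comp_measurable hX
  have hle : ∀ k ω, (maxInner u k (X ω) : EReal) ≤ F ω := fun k ω =>
    le_iSup (fun k => (maxInner u k (X ω) : EReal)) k
  -- Only this one-sided comparison is needed, not convergence of the expectations; it also covers
  -- an infinite expectation of F.
  have hexp : ∀ k, ((∫ ω, maxInner u k (X ω) ∂P : ℝ) : EReal) ≤ expectation P F := fun k => by
    rw [← expectation_coe (hint k)]
    exact expectation_mono (hle k)
  refine ⟨⟨Measurable.iSup fun k => measurable_coe_real_ereal.comp (hmm k), Or.inr ?_⟩,
    fun s hs => ?_⟩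
  · have h1 : ∫⁻ ω, ENNReal.ofReal (-maxInner u 0 (X ω)) ∂P < ∞ := (hint 0).neg.lintegral_lt_top
    refine (lt_of_le_of_lt (lintegral_mono fun ω => ?_) h1).ne
    refine (EReal.toENNReal_le_toENNReal (EReal.neg_le_neg_iff.2 (hle 0 ω))).trans (le_of_eq ?_)
    rw [← EReal.coe_neg, EReal.toENNReal_of_ne_top (EReal.coe_ne_top _), EReal.toReal_coe]
  · rcases eq_or_ne (supNorm A) ∞ with htop | htop
    · rw [htop]
      refine prob_le_one.trans (le_of_eq ?_)
      simp [gaussianBound, ENNReal.mul_top, hC]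
    have hnorm : ∀ i, ‖u i‖ ≤ (supNorm A).toReal := fun i => by
      rw [← toReal_enorm]
      exact ENNReal.toReal_mono htop (le_iSup₂ (f := fun z (_ : z ∈ A) => ‖z‖ₑ) (u i) (hu i))
    rcases eq_or_ne (supNorm A) 0 with hzero | hzero
    · have hu0 : ∀ i, u i = 0 := fun i => by simpa [hzero] using hnorm i
      have hF0 : F = fun _ => ((0 : ℝ) : EReal) := by
        funext ω
        simp [hF, maxInner, hu0]
      change P {ω | F ω > expectation P F + (s : EReal)} ≤ _
      rw [hF0, expectation_coe (integrable_const _)]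
      simp [hs.not_gt]
    have hvpos : 0 < (supNorm A).toReal := ENNReal.toReal_pos hzero htop
    rw [← ENNReal.ofReal_toReal htop, gaussianBound_ofReal hC hvpos]
    set v := (supNorm A).toReal
    -- Strict inequality makes the event an increasing union, so a bound uniform in k suffices.
    have hset : {ω | F ω > expectation P F + (s : EReal)} =
        ⋃ k, {ω | expectation P F + (s : EReal) < (maxInner u k (X ω) : EReal)} := by
      ext ω
      simp [hF, lt_iSup_iff]
    have hmono : Monotone fun k =>
        {ω | expectation P F + (s : EReal) < (maxInner u k (X ω) : EReal)} :=
      fun k l hkl ω hω => lt_of_lt_of_le hω (EReal.coe_le_coe_iff.2 (maxInner_mono (X ω) hkl))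
    rw [hset, hmono.measure_iUnion]
    refine iSup_le fun k => ?_
    have hsub : {ω | expectation P F + (s : EReal) < (maxInner u k (X ω) : EReal)} ⊆
        X ⁻¹' {x | ∫ y, maxInner u k y ∂(P.map X) + s ≤ maxInner u k x} := fun ω hω => by
      have h1 : ((∫ ω, maxInner u k (X ω) ∂P : ℝ) : EReal) + (s : EReal) <
          (maxInner u k (X ω) : EReal) := lt_of_le_of_lt (add_le_add_left (hexp k) _) hω
      rw [← EReal.coe_add, EReal.coe_lt_coe_iff] at h1
      simp only [Set.mem_preimage, Set.mem_ofPred_eq]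
      rw [integral_map hX.aemeasurable (continuous_maxInner k).aestronglyMeasurable]
      exact h1.le
    refine (measure_mono hsub).trans ?_
    rw [← Measure.map_apply hX (measurableSet_le measurable_const
      (continuous_maxInner k).measurable), ← ofReal_measureReal]
    refine ENNReal.ofReal_le_ofReal ((h.measure_maxInner_ge_le (by positivity) hvpos hs
      fun i _ => hnorm i).trans (le_of_eq ?_))
    congr 1
    field_simp

theorem theorem4 {n : ℕ} (A : Set (EuclideanSpace ℝ (Fin n)))
    {Ω : Type*} [MeasurableSpace Ω] (P : Measure Ω) [IsProbabilityMeasure P]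
    (ε : Fin n → Ω → ℝ) (hmeas : ∀ i, Measurable (ε i)) (hindep : iIndepFun ε P)
    (F : Ω → EReal) (hF : ∀ ω, F ω = supInner A (WithLp.toLp 2 (fun i => ε i ω))) :
    ((∀ i, ∀ᵐ ω ∂P, |ε i ω| ≤ 1) →
      HasExpectation P F ∧
      ∀ s : ℝ, 0 < s →
        P {ω | F ω > expectation P F + (s : EReal)} ≤ gaussianBound 8 s (supNorm A)) ∧
    ((∀ i, P.map (ε i) = gaussianReal 0 1) →
      HasExpectation P F ∧
      ∀ s : ℝ, 0 < s →
        P {ω | F ω > expectation P F + (s : EReal)} ≤ gaussianBound 2 s (supNorm A)) := by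
  have hX : Measurable fun ω i => ε i ω := measurable_pi_lambda _ hmeas
  have hlaw := (iIndepFun_iff_map_fun_eq_pi_map fun i => (hmeas i).aemeasurable).1 hindep
  obtain rfl : F = fun ω => supInner A (WithLp.toLp 2 (fun i => ε i ω)) := funext hF
  have hprob : ∀ i, IsProbabilityMeasure (P.map (ε i)) := fun i =>
    Measure.isProbabilityMeasure_map (hmeas i).aemeasurable
  refine ⟨fun hb => ?_, fun hg => ?_⟩
  · have h := convexSubgaussian_pi_of_ae_mem_Icc (μ := fun i => P.map (ε i)) fun i =>
      (ae_map_iff (hmeas i).aemeasurable measurableSet_Icc).2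
        ((hb i).mono fun ω hω => abs_le.1 hω)
    rw [← hlaw] at h
    simpa using h.hasExpectation_and_tail (C := 8) (by norm_num) A P hX
  · have h := convexSubgaussian_pi_gaussianReal (n := n)
    simp only [hg] at hlaw
    rw [← hlaw] at h
    simpa using h.hasExpectation_and_tail (C := 2) (by norm_num) A P hX
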